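/- Let $X$ be a compact metric space with its Borel $\sigma$-algebra, let $A\subset\mathbb R^m$ be compact and convex, let $0\le\beta<1$, and let $c:X\times A\times\mathcal P(X)\to\mathbb R$ be a cost function and $p:X\times A\times\mathcal P(X)\to\mathcal P(X)$ a transition probability. Here $\mathcal P(\cdot)$ denotes Borel probability measures with the weak topology. Assume: (i) if $(x_n,a_n,\mu_n)\to(x,a,\mu)$ in $X\times A\times\mathcal P(X)$, then $c(x_n,a_n,\mu_n)\to c(x,a,\mu)$ and $p(\cdot|x_n,a_n,\mu_n)\to p(\cdot|x,a,\mu)$ weakly; (ii) $c$ is bounded, and there are constants $L,K\ge 0$ such that for all $x,x'\in X$, $a,a'\in A$, $\mu\in\mathcal P(X)$, $$|c(x,a,\mu)-c(x',a',\mu)|\le L\,(d_X(x,x')+\|a-a'\|),\qquad W_1(p(\cdot|x,a,\mu),p(\cdot|x',a',\mu))\le K\,(d_X(x,x')+\|a-a'\|),$$ where $W_1(\mu,\nu)=\sup\{|\int g\,d\mu-\int g\,d\nu| : g \text{ is } 1\text{-Lipschitz}\}$. A policy is a stochastic kernel $\pi(da|x)$ from $X$ to $A$, and $\pi\otimes\mu$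 is the law $\pi(da|x)\mu(dx)$ on $X\times A$. Given an initial law and sequences $(\pi_t)$ of policies and $(\mu_t)$ of state measures, let $a_t\sim\pi_t(\cdot|x_t)$ and $x_{t+1}\sim p(\cdot|x_t,a_t,\mu_t)$. Fix $\mu_0\in\mathcal P(X)$. * A mean-field equilibrium (MFE) of the $T$-horizon game is a pair $(\pi_t,\mu_t)_{t=0}^T$, whose measure at time $0$ is the given $\mu_0$, such that $\mu_{t+1}=\int p(\cdot|x,a,\mu_t)\,\pi_t(da|x)\mu_t(dx)$ for $t<T$, and $(\pi_t)$ minimizes $E\big[\sum_{t=0}^T\beta^t c(x_t,a_t,\mu_t)\big]$ with $x_0\sim\mu_0$ over all Markov policies, the flow $(\mu_t)$ being held fixed. A non-stationary MFE $(\pi_t,\mu_t)_{t\ge0}$ is defined in the same way with $T=\infty$. * A stationary MFE is a pair $(\pi,\mu)$ with $\mu=\int p(\cdot|x,a,\mu)\,\pi(da|x)\mu(dx)$ such that using $\pi$ at all times minimizes $E\big[\sum_{t\ge0}\beta^tc(x_t,a_t,\mu)\big]$ with $x_0\sim\mu$ over all Markov policies. * The extension $(\tilde\pi^T_t,\tilde\mu^T_t)_{t\ge0}$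 of a $T$-horizon MFE $(\pi^T_t,\mu^T_t)_{t=0}^T$ is $(\pi^T_{\min(t,T)},\mu^T_{\min(t,T)})_{t\ge0}$. * An asymptotically discount optimal MFE is a non-stationary MFE $(\hat\pi_t,\hat\mu_t)_{t\ge0}$ such that $\hat\pi_t\otimes\hat\mu_t$ converges weakly, as $t\to\infty$, to $\pi\otimes\mu$ for some stationary MFE $(\pi,\mu)$. For each $T\ge1$ let $(\tilde\pi^T_t,\tilde\mu^T_t)_{t\ge0}$ be the extension of an MFE $(\pi^T_t,\mu^T_t)_{t=0}^T$ of the $T$-horizon game. Suppose that there is an asymptotically discount optimal MFE $(\hat\pi_t,\hat\mu_t)_{t\ge0}$ with $\lim_{T\to\infty}\tilde\pi^T_t\otimes\tilde\mu^T_t=\hat\pi_t\otimes\hat\mu_t$ weakly for every $t\ge0$, and let $(\pi,\mu)$ be a stationary MFE with $\lim_{t\to\infty}\hat\pi_t\otimes\hat\mu_t=\pi\otimes\mu$ weakly. Then the finite-horizon MFE approximate $(\pi,\mu)$: for every weak neighbourhood $U$ of $\pi\otimes\mu$ in $\mathcal P(X\times A)$ there is $t_0$ such that for every $t\ge t_0$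 there is $T_0\ge t$ with $\pi^T_t\otimes\mu^T_t\in U$ for all $T\ge \max(T_0,1)$; and for every weak neighbourhood $V$ of $\mu$ in $\mathcal P(X)$ there is $t_0$ such that for every $t\ge t_0$ there is $T_0\ge t$ with $\mu^T_t\in V$ for all $T\ge \max(T_0,1)$. -/

import Mathlib

open MeasureTheory ProbabilityTheory Filter Topology
open scoped ENNReal

namespace MeanField

noncomputable section

/-- A (one-stage, possibly randomized) policy: a stochastic kernel from states to actions. -/
def Policy (X A : Type*) [MeasurableSpace X] [MeasurableSpace A] :=
  {κ : Kernel X A // IsMarkovKernel κ}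

instance {X A : Type*} [MeasurableSpace X] [MeasurableSpace A] (π : Policy X A) :
    IsMarkovKernel π.1 := π.2

/-- The joint law `π(da|x) μ(dx)` on state-action pairs. -/
def joint {X A : Type*} [MeasurableSpace X] [MeasurableSpace A]
    (π : Policy X A) (μ : ProbabilityMeasure X) : ProbabilityMeasure (X × A) :=
  ⟨(μ : Measure X) ⊗ₘ π.1, inferInstance⟩

/-- The data of a discounted mean-field game: cost `c`, transition probability `p`,
discount factor `β`. The initial state-measure and the horizon are supplied separately. -/
structure Game (X A : Type*) [MeasurableSpace X] [MeasurableSpace A] where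
  c : X → A → ProbabilityMeasure X → ℝ
  p : X → A → ProbabilityMeasure X → ProbabilityMeasure X
  β : ℝ
  measurable_c : ∀ μ, Measurable fun z : X × A => c z.1 z.2 μ
  measurable_p : ∀ μ, Measurable fun z : X × A => (p z.1 z.2 μ : Measure X)
  β_nonneg : 0 ≤ β
  β_lt_one : β < 1

section Dynamics

variable {X A : Type*} [MeasurableSpace X] [MeasurableSpace A]

/-- `p(·|x,a,μ)` as a stochastic kernel in `(x,a)`, for a fixed state-measure `μ`. -/
def Game.transition (G : Game X A) (μ : ProbabilityMeasure X) : Kernel (X × A) X where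
  toFun z := (G.p z.1 z.2 μ : Measure X)
  measurable' := G.measurable_p μ

instance (G : Game X A) (μ : ProbabilityMeasure X) : IsMarkovKernel (G.transition μ) :=
  ⟨fun z => inferInstanceAs (IsProbabilityMeasure (G.p z.1 z.2 μ : Measure X))⟩

/-- One step of the state-action process: from `(x,a)` draw `x' ∼ p(·|x,a,μ)`, then
`a' ∼ π(·|x')`. -/
def Game.step (G : Game X A) (μ : ProbabilityMeasure X) (π : Policy X A) :
    Kernel (X × A) (X × A) :=
  G.transition μ ⊗ₖ Kernel.prodMkLeft (X × A) π.1

instance (G : Game X A) (μ : ProbabilityMeasure X) (π : Policy X A) :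
    IsMarkovKernel (G.step μ π) := by
  unfold Game.step; infer_instance

/-- The step at time `n`, as a kernel from the history up to time `n`
(it reads only the last state-action pair). -/
def Game.historyStep (G : Game X A) (π : ℕ → Policy X A) (μ : ℕ → ProbabilityMeasure X) (n : ℕ) :
    Kernel ((i : Finset.Iic n) → (fun _ : ℕ => X × A) i) (X × A) :=
  (G.step (μ n) (π (n + 1))).comap
    (fun h => h ⟨n, Finset.mem_Iic.2 le_rfl⟩) (measurable_pi_apply _)

instance (G : Game X A) (π : ℕ → Policy X A) (μ : ℕ → ProbabilityMeasure X) (n : ℕ) :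
    IsMarkovKernel (G.historyStep π μ n) := by
  unfold Game.historyStep; infer_instance

/-- Law of the state-action trajectory `(x_t, a_t)_{t ≥ 0}` with `x_0 ∼ ν`, `a_t ∼ π_t(·|x_t)`,
`x_{t+1} ∼ p(·|x_t, a_t, μ_t)`. -/
def Game.trajectoryLaw (G : Game X A) (ν : ProbabilityMeasure X) (π : ℕ → Policy X A)
    (μ : ℕ → ProbabilityMeasure X) : Measure (ℕ → X × A) :=
  Kernel.trajMeasure (X := fun _ : ℕ => X × A)
    (joint (π 0) ν : Measure (X × A)) (G.historyStep π μ)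

/-- A flow indexed by `0, …, T`, continued after time `T` by its value at time `T`. -/
def extend {α : Type*} {T : ℕ} (f : Fin (T + 1) → α) (t : ℕ) : α :=
  f ⟨min t T, Nat.lt_succ_of_le (min_le_right t T)⟩

/-- Expected discounted cost over the horizon `0, …, T`. Only the coordinates `0, …, T` of the
trajectory enter, so the continuation of the flows after time `T` is immaterial. -/
def Game.finiteCost (G : Game X A) {T : ℕ} (μ₀ : ProbabilityMeasure X)
    (π : Fin (T + 1) → Policy X A) (μ : Fin (T + 1) → ProbabilityMeasure X) : ℝ :=
  ∫ ω, ∑ t : Fin (T + 1), G.β ^ (t : ℕ) * G.c (ω t).1 (ω t).2 (μ t)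
    ∂(G.trajectoryLaw μ₀ (extend π) (extend μ))

/-- Expected discounted cost over the infinite horizon. -/
def Game.infiniteCost (G : Game X A) (μ₀ : ProbabilityMeasure X)
    (π : ℕ → Policy X A) (μ : ℕ → ProbabilityMeasure X) : ℝ :=
  ∫ ω, ∑' t : ℕ, G.β ^ t * G.c (ω t).1 (ω t).2 (μ t) ∂(G.trajectoryLaw μ₀ π μ)

/-- `∫ p(·|x,a,μ) π(da|x) μ(dx)`. -/
def Game.nextState (G : Game X A) (π : Policy X A) (μ : ProbabilityMeasure X) : Measure X :=
  (joint π μ : Measure (X × A)).bind (G.transition μ)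

/-- Mean-field equilibrium of the `T`-horizon game with initial state-measure `μ₀`. -/
structure Game.IsFiniteMFE (G : Game X A) (μ₀ : ProbabilityMeasure X) {T : ℕ}
    (π : Fin (T + 1) → Policy X A) (μ : Fin (T + 1) → ProbabilityMeasure X) : Prop where
  initial : μ 0 = μ₀
  evolution : ∀ t : Fin T, (μ t.succ : Measure X) = G.nextState (π t.castSucc) (μ t.castSucc)
  optimal : ∀ π' : Fin (T + 1) → Policy X A, G.finiteCost μ₀ π μ ≤ G.finiteCost μ₀ π' μ

/-- The infinite flow `(π, μ)` is the extension of a mean-field equilibrium of the `T`-horizon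
game, frozen after time `T`. -/
def Game.IsExtendedMFE (G : Game X A) (μ₀ : ProbabilityMeasure X) (T : ℕ)
    (π : ℕ → Policy X A) (μ : ℕ → ProbabilityMeasure X) : Prop :=
  ∃ (π' : Fin (T + 1) → Policy X A) (μ' : Fin (T + 1) → ProbabilityMeasure X),
    G.IsFiniteMFE μ₀ π' μ' ∧ π = extend π' ∧ μ = extend μ'

/-- Mean-field equilibrium of the infinite-horizon non-stationary game. -/
structure Game.IsNonstationaryMFE (G : Game X A) (μ₀ : ProbabilityMeasure X)
    (π : ℕ → Policy X A) (μ : ℕ → ProbabilityMeasure X) : Prop where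
  initial : μ 0 = μ₀
  evolution : ∀ t, (μ (t + 1) : Measure X) = G.nextState (π t) (μ t)
  optimal : ∀ π' : ℕ → Policy X A, G.infiniteCost μ₀ π μ ≤ G.infiniteCost μ₀ π' μ

/-- Mean-field equilibrium of the stationary game: `μ` is invariant under `π`, and using `π` at
all times is optimal, among all Markov policies, against the constant flow `μ` from `x_0 ∼ μ`. -/
structure Game.IsStationaryMFE (G : Game X A) (π : Policy X A) (μ : ProbabilityMeasure X) :
    Prop where
  invariant : (μ : Measure X) = G.nextState π μ
  optimal : ∀ π' : ℕ → Policy X A,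
    G.infiniteCost μ (fun _ => π) (fun _ => μ) ≤ G.infiniteCost μ π' (fun _ => μ)

end Dynamics

/-- Asymptotically discount optimal MFE: a non-stationary MFE whose joint laws converge weakly to
the joint law of some stationary MFE. -/
def Game.IsADOMFE {X A : Type*} [TopologicalSpace X] [MeasurableSpace X] [TopologicalSpace A]
    [MeasurableSpace A] [OpensMeasurableSpace (X × A)] (G : Game X A) (μ₀ : ProbabilityMeasure X)
    (π : ℕ → Policy X A) (μ : ℕ → ProbabilityMeasure X) : Prop :=
  G.IsNonstationaryMFE μ₀ π μ ∧
    ∃ (πs : Policy X A) (μs : ProbabilityMeasure X), G.IsStationaryMFE πs μs ∧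
      Tendsto (fun t => joint (π t) (μ t)) atTop (𝓝 (joint πs μs))

/-- Continuous convergence of `c` and weakly continuous convergence of `p`. -/
def Game.IsContinuous {X A : Type*} [TopologicalSpace X] [MeasurableSpace X]
    [OpensMeasurableSpace X] [TopologicalSpace A] [MeasurableSpace A] (G : Game X A) : Prop :=
  ∀ (xs : ℕ → X) (as : ℕ → A) (μs : ℕ → ProbabilityMeasure X)
    (x : X) (a : A) (μ : ProbabilityMeasure X),
    Tendsto xs atTop (𝓝 x) → Tendsto as atTop (𝓝 a) → Tendsto μs atTop (𝓝 μ) →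
      Tendsto (fun n => G.c (xs n) (as n) (μs n)) atTop (𝓝 (G.c x a μ)) ∧
      Tendsto (fun n => G.p (xs n) (as n) (μs n)) atTop (𝓝 (G.p x a μ))

/-- The `1`-Wasserstein distance on a compact metric space, in dual form. -/
def wasserstein {X : Type*} [MetricSpace X] [CompactSpace X] [MeasurableSpace X]
    (μ ν : ProbabilityMeasure X) : ℝ≥0∞ :=
  ⨆ (g : X → ℝ) (_ : LipschitzWith 1 g),
    ENNReal.ofReal |∫ x, g x ∂(μ : Measure X) - ∫ x, g x ∂(ν : Measure X)|

/-- `c` is bounded, and `c`, `p` are Lipschitz in `(x,a)` uniformly in the state-measure. -/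
def Game.IsLipschitz {X A : Type*} [MetricSpace X] [CompactSpace X] [MeasurableSpace X]
    [MetricSpace A] [MeasurableSpace A] (G : Game X A) : Prop :=
  ∃ L K M : ℝ, 0 ≤ L ∧ 0 ≤ K ∧
    (∀ x x' a a' μ, |G.c x a μ - G.c x' a' μ| ≤ L * (dist x x' + dist a a')) ∧
    (∀ x x' a a' μ,
      wasserstein (G.p x a μ) (G.p x' a' μ) ≤ ENNReal.ofReal (K * (dist x x' + dist a a'))) ∧
    (∀ x a μ, |G.c x a μ| ≤ M)

end

end MeanField

namespace MeanField

/-! The conclusion is an iterated limit, `T → ∞` first and then `t → ∞`, of joint laws in the weak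
topology. An open neighbourhood of the final limit contains the intermediate limits for all late
`t`, hence also the approximants for `T` large depending on `t`; no uniformity in `t` enters. This
is `exists_forall_mem_of_tendsto_of_tendsto`. The statement on state-measures follows from the same
argument, since taking the state marginal is weakly continuous (`tendsto_of_tendsto_joint`). -/

/-- The state marginal of `π(da|x) μ(dx)` is `μ`. -/
theorem map_fst_joint {X A : Type*} [MeasurableSpace X] [MeasurableSpace A]
    (π : Policy X A) (μ : ProbabilityMeasure X) :
    (joint π μ).map measurable_fst.aemeasurable = μ :=
  Subtype.ext (Measure.fst_compProd (μ : Measure X) π.1)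

/-- Weak convergence of the joint laws implies weak convergence of the state-measures. -/
theorem tendsto_of_tendsto_joint {X A ι : Type*} [TopologicalSpace X] [MeasurableSpace X]
    [BorelSpace X] [TopologicalSpace A] [MeasurableSpace A] [OpensMeasurableSpace (X × A)]
    {l : Filter ι} {πs : ι → Policy X A} {μs : ι → ProbabilityMeasure X} {π : Policy X A}
    {μ : ProbabilityMeasure X}
    (h : Tendsto (fun i => joint (πs i) (μs i)) l (𝓝 (joint π μ))) :
    Tendsto μs l (𝓝 μ) := by
  simpa only [map_fst_joint] using
    ProbabilityMeasure.tendsto_map_of_tendsto_of_continuous _ _ h continuous_fst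

end MeanField

/-- Iterated limits along `ℕ`: if `f T t → g t` as `T → ∞` for every `t` and `g t → y`, then
every neighbourhood of `y` eventually contains `f T t`, for `T` large depending on `t`. -/
theorem exists_forall_mem_of_tendsto_of_tendsto {Y : Type*} [TopologicalSpace Y]
    {f : ℕ → ℕ → Y} {g : ℕ → Y} {y : Y} (hf : ∀ t, Tendsto (fun T => f T t) atTop (𝓝 (g t)))
    (hg : Tendsto g atTop (𝓝 y)) {U : Set Y} (hU : U ∈ 𝓝 y) :
    ∃ t₀ : ℕ, ∀ t ≥ t₀, ∃ T₀ ≥ t, ∀ T ≥ T₀, f T t ∈ U := by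
  -- `U` is eventually a neighbourhood of `g t`, not merely a set containing it; the limit in `T`
  -- needs this stronger form, as `U` need not be open.
  obtain ⟨t₀, ht₀⟩ := eventually_atTop.1 (hg.eventually (eventually_mem_nhds_iff.2 hU))
  refine ⟨t₀, fun t ht => ?_⟩
  obtain ⟨T₁, hT₁⟩ := eventually_atTop.1 ((hf t).eventually (ht₀ t ht))
  -- The maximum with `t` gives `T ≥ t`. For an extended flow this means that `min t T = t`, so its
  -- value at `t` belongs to the finite-horizon equilibrium itself rather than to the frozen tail.
  exact ⟨max T₁ t, le_max_right _ _, fun T hT => hT₁ T ((le_max_left _ _).trans hT)⟩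

theorem mainTheorem11 {X : Type*} [MetricSpace X] [CompactSpace X] [MeasurableSpace X]
    [BorelSpace X] {m : ℕ} (S : Set (EuclideanSpace ℝ (Fin m))) (hS : IsCompact S)
    (hSconv : Convex ℝ S) (G : MeanField.Game X S) (hcont : G.IsContinuous)
    (hLip : G.IsLipschitz) (μ₀ : ProbabilityMeasure X)
    (πE : ℕ → ℕ → MeanField.Policy X S) (μE : ℕ → ℕ → ProbabilityMeasure X)
    (hE : ∀ T, 1 ≤ T → G.IsExtendedMFE μ₀ T (πE T) (μE T))
    (πhat : ℕ → MeanField.Policy X S) (μhat : ℕ → ProbabilityMeasure X)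
    (hADO : G.IsADOMFE μ₀ πhat μhat)
    (hlimT : ∀ t, Tendsto (fun T => MeanField.joint (πE T t) (μE T t)) atTop
      (𝓝 (MeanField.joint (πhat t) (μhat t))))
    (π : MeanField.Policy X S) (μ : ProbabilityMeasure X) (hs : G.IsStationaryMFE π μ)
    (hlimt : Tendsto (fun t => MeanField.joint (πhat t) (μhat t)) atTop
      (𝓝 (MeanField.joint π μ))) :
    (∀ U ∈ 𝓝 (MeanField.joint π μ), ∃ t₀ : ℕ, ∀ t ≥ t₀, ∃ T₀ ≥ t, ∀ T ≥ T₀,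
      MeanField.joint (πE T t) (μE T t) ∈ U) ∧
    (∀ U ∈ 𝓝 μ, ∃ t₀ : ℕ, ∀ t ≥ t₀, ∃ T₀ ≥ t, ∀ T ≥ T₀, μE T t ∈ U) := by
  exact ⟨fun _ hU => exists_forall_mem_of_tendsto_of_tendsto hlimT hlimt hU,
    -- Both limits are projected to state marginals before they are iterated in `ProbabilityMeasure
    -- X`.
    fun _ hU => exists_forall_mem_of_tendsto_of_tendsto
      (fun t => MeanField.tendsto_of_tendsto_joint (hlimT t))
      (MeanField.tendsto_of_tendsto_joint hlimt) hU⟩
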